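/- For a finite simple graph $G$ with adjacency matrix $A(G)$ and diagonal degree matrix $D(G)$, and for $\alpha\in[0,1)$, let $A_\alpha(G)=\alpha D(G)+(1-\alpha)A(G)$ and let $\rho_\alpha(G)$ denote the largest eigenvalue of $A_\alpha(G)$. Write $G\cup H$ for the disjoint union of two graphs, $2K_1$ for $K_1\cup K_1$, and $G\nabla H$ for the join, i.e. $G\cup H$ together with all edges between $G$ and $H$. Put $$f(\alpha)=\begin{cases}10,& 0\le\alpha\le 1/2,\\ 14,& 1/2<\alpha\le 2/3,\\ 5/(1-\alpha),& 2/3<\alpha<1.\end{cases}$$ **Theorem.** Let $\alpha\in[0,1)$ and let $G$ be a connected graph of even order $n\ge f(\alpha)$. If $$\rho_\alpha(G)\ \ge\ \rho_\alpha\bigl(K_1\nabla(K_{n-3}\cup 2K_1)\bigr),$$ then $G$ has a perfect matching unless $G$ is isomorphic to $K_1\nabla(K_{n-3}\cup 2K_1)$, in which case it has none. Moreover, $\rho_\alpha(K_1\nabla(K_{n-3}\cup 2K_1))$ is equal to the largest real root of $$x^3-\bigl((\alpha+1)n+\alpha-4\bigr)x^2+\bigl(\alpha n^2+(\alpha^2-2\alpha-1)n-2\alpha+1\bigr)x-\alpha^2n^2+(5\alpha^2-3\alpha+2)n-10\alpha^2+15\alpha-8=0.$$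 -/

import Mathlib

namespace AlphaSpectral

open SimpleGraph

open Classical in
/-- The matrix `α D(G) + (1 - α) A(G)`, with `D(G)` the diagonal matrix of vertex degrees and
`A(G)` the adjacency matrix. -/
noncomputable def alphaMatrix {V : Type*} [Fintype V] (G : SimpleGraph V) (α : ℝ) :
    Matrix V V ℝ :=
  α • G.degMatrix ℝ + (1 - α) • G.adjMatrix ℝ

open Classical in
/-- The `A_α`-spectral radius: the largest eigenvalue of the real symmetric matrix
`alphaMatrix G α`. (The set of eigenvalues is finite, and it is nonempty when `V` is nonempty.) -/
noncomputable def alphaSpectralRadius {V : Type*} [Fintype V] (G : SimpleGraph V) (α : ℝ) : ℝ :=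
  sSup {μ : ℝ | Module.End.HasEigenvalue (Matrix.toLin' (alphaMatrix G α)) μ}

/-- The join `G ∇ H`: the disjoint union of `G` and `H` together with all edges between them. -/
def join {V W : Type*} (G : SimpleGraph V) (H : SimpleGraph W) : SimpleGraph (V ⊕ W) :=
  (G ⊕g H) ⊔ completeBipartiteGraph V W

/-- The graph `K₁ ∇ (K_{n-3} ∪ 2K₁)`, of order `n` when `n ≥ 3`; the edgeless graph on two vertices
is `2K₁`. -/
def extremalGraph (n : ℕ) : SimpleGraph (Fin 1 ⊕ (Fin (n - 3) ⊕ Fin 2)) :=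
  join (completeGraph (Fin 1)) (completeGraph (Fin (n - 3)) ⊕g (⊥ : SimpleGraph (Fin 2)))

/-- The lower bound `f(α)` on the order, for `0 ≤ α < 1`. -/
noncomputable def orderBound (α : ℝ) : ℝ :=
  if α ≤ 1 / 2 then 10 else if α ≤ 2 / 3 then 14 else 5 / (1 - α)

/-- The cubic polynomial (in `x`) whose largest root is the threshold. -/
def thresholdCubic (α n x : ℝ) : ℝ :=
  x ^ 3 - ((α + 1) * n + α - 4) * x ^ 2
    + (α * n ^ 2 + (α ^ 2 - 2 * α - 1) * n - 2 * α + 1) * x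
    - α ^ 2 * n ^ 2 + (5 * α ^ 2 - 3 * α + 2) * n - 10 * α ^ 2 + 15 * α - 8

end AlphaSpectral

/-! Suppose `G` has no perfect matching. Tutte's theorem and parity give a separator of `s` vertices
leaving `t ≥ s + 2` components, of orders `k i`. So `G` lies inside the join of `K_s` with disjoint
cliques of orders `k i`. Let `r > n - 3` be a root of the cubic. The aim is a positive vector `x`
with `A_α x ≤ r x`; a Perron–Frobenius comparison then bounds every eigenvalue by `r`, and attaining
`r` forces `A_α x = r x`.

Take `x` constant on the separator and on each component, with the component values solving their
rows exactly for the eigenvalue `r`. Only the separator rows remain, and they involve `∑ k i / (c -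
k i)`. By convexity this sum is at most its value for `s + 1` singletons and one clique of order `n
- 2 s - 1` (`div_sub_le_chord`), and `center_row_bound` shows that this extreme case stays below
`r`, with equality only for `s = 1`. If `G` reaches the threshold, all these inequalities are
equalities, which identifies `G`.

The same comparison shows that a positive eigenvector can only belong to the largest eigenvalue.
Every root above `n - 3` yields one for `extremalGraph n`, so there is exactly one such root and it
is the spectral radius. -/

namespace AlphaSpectral

open SimpleGraph

/-! ### Perron–Frobenius comparison for `A_α`, and the spectrum of the extremal graph. -/

section Spectral

open Classical in
lemma alphaMatrix_mulVec {V : Type*} [Fintype V] (G : SimpleGraph V) (α : ℝ) (x : V → ℝ) (v : V) :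
    Matrix.mulVec (alphaMatrix G α) x v
      = ∑ u, if G.Adj v u then α * x v + (1 - α) * x u else 0 := by
  have h1 : ((G.degree v : ℕ) : ℝ) = ∑ u, if G.Adj v u then (1 : ℝ) else 0 := by
    rw [Finset.sum_boole, ← card_neighborFinset_eq_degree]
    congr 2
    ext u
    simp
  rw [alphaMatrix, Matrix.add_mulVec, Matrix.smul_mulVec, Matrix.smul_mulVec]
  simp only [Pi.add_apply, Pi.smul_apply, smul_eq_mul, degMatrix, Matrix.mulVec_diagonal, h1]
  rw [adjMatrix_mulVec_apply, Finset.sum_mul, Finset.mul_sum]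
  have h2 : ∑ u ∈ G.neighborFinset v, (1 - α) * x u
      = ∑ u, if G.Adj v u then (1 - α) * x u else 0 := by
    rw [← Finset.sum_filter]
    congr 1
    ext u
    simp
  rw [Finset.mul_sum, h2, ← Finset.sum_add_distrib]
  refine Finset.sum_congr rfl fun u _ => ?_
  split_ifs <;> ring

/-- If a nonnegative vector with a zero at `v₀` is mapped by `A_α` to a vector that is nonpositive
at the zeros, then it vanishes, provided the graph is connected. -/
lemma eq_zero_of_mulVec_le {V : Type*} [Fintype V] {G : SimpleGraph V} {α r : ℝ}
    (hα1 : α < 1) (hG : G.Connected) {z : V → ℝ} (hz : ∀ v, 0 ≤ z v)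
    (hMz : ∀ v, Matrix.mulVec (alphaMatrix G α) z v ≤ r * z v) {v₀ : V} (h0 : z v₀ = 0) (v : V) :
    z v = 0 := by
  classical
  have step : ∀ u w, G.Adj u w → z u = 0 → z w = 0 := by
    intro u w huw hu
    have h := hMz u
    rw [alphaMatrix_mulVec, hu] at h
    replace h := h.trans_eq (mul_zero r)
    have hnn : ∀ t ∈ Finset.univ,
        0 ≤ if G.Adj u t then α * 0 + (1 - α) * z t else 0 := by
      intro t _
      split_ifs
      · nlinarith [hz t]
      · exact le_rfl
    have h' := (Finset.sum_eq_zero_iff_of_nonneg hnn).1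
      (le_antisymm h (Finset.sum_nonneg hnn)) w (Finset.mem_univ _)
    rw [if_pos huw] at h'
    have : (1 - α) * z w = 0 := by linarith
    rcases mul_eq_zero.1 this with h | h
    · linarith
    · exact h
  obtain ⟨p⟩ := hG.preconnected v₀ v
  induction p with
  | nil => exact h0
  | cons hadj _ ih => exact ih (step _ _ hadj h0)

/-- The triangle inequality makes `y = |w|` subinvariant for an eigenvector `w`, and `K` is the
largest ratio `|w v| / x v`. So `K x - y` is nonnegative with a zero at `v₀`, the situation of
`eq_zero_of_mulVec_le`. -/
lemma exists_comparison {V : Type*} [Fintype V] [DecidableEq V] {G : SimpleGraph V} {α μ : ℝ}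
    (hα0 : 0 ≤ α) (hα1 : α < 1) {x : V → ℝ} (hx : ∀ v, 0 < x v)
    (hμ : Module.End.HasEigenvalue (Matrix.toLin' (alphaMatrix G α)) μ) :
    ∃ (K : ℝ) (y : V → ℝ) (v₀ : V), 0 < K ∧ (∀ v, y v ≤ K * x v) ∧ y v₀ = K * x v₀ ∧
      ∀ v, μ * y v ≤ Matrix.mulVec (alphaMatrix G α) y v := by
  obtain ⟨w, hw⟩ := hμ.exists_hasEigenvector
  have hMw : ∀ v, Matrix.mulVec (alphaMatrix G α) w v = μ * w v := fun v => by
    have := congrFun hw.apply_eq_smul v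
    simpa using this
  obtain ⟨v₁, hv₁⟩ : ∃ v, w v ≠ 0 := by
    by_contra! h
    exact hw.2 (funext h)
  obtain ⟨v₀, -, hmax⟩ :=
    Finset.exists_max_image Finset.univ (fun v => |w v| / x v) ⟨v₁, Finset.mem_univ _⟩
  refine ⟨|w v₀| / x v₀, fun v => |w v|, v₀, ?_, ?_, ?_, ?_⟩
  · exact lt_of_lt_of_le (div_pos (abs_pos.2 hv₁) (hx v₁)) (hmax v₁ (Finset.mem_univ _))
  · intro v
    have := hmax v (Finset.mem_univ _)
    rwa [div_le_iff₀ (hx v)] at this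
  · field_simp [(hx v₀).ne']
  · intro v
    calc μ * |w v| ≤ |μ * w v| := by
          rw [abs_mul]; exact mul_le_mul_of_nonneg_right (le_abs_self _) (abs_nonneg _)
      _ = |Matrix.mulVec (alphaMatrix G α) w v| := by rw [hMw]
      _ ≤ _ := by
          rw [alphaMatrix_mulVec, alphaMatrix_mulVec]
          refine (Finset.abs_sum_le_sum_abs _ _).trans (Finset.sum_le_sum fun u _ => ?_)
          split_ifs
          · refine (abs_add_le _ _).trans ?_
            rw [abs_mul, abs_mul, abs_of_nonneg hα0, abs_of_nonneg (sub_nonneg.2 hα1.le)]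
          · simp

lemma mulVec_sub_smul {V : Type*} [Fintype V] (G : SimpleGraph V) (α K : ℝ) (x y : V → ℝ) (v : V) :
    Matrix.mulVec (alphaMatrix G α) (fun u => K * x u - y u) v =
      K * Matrix.mulVec (alphaMatrix G α) x v - Matrix.mulVec (alphaMatrix G α) y v := by
  have : (fun u => K * x u - y u) = K • x - y := by ext; simp
  rw [this, Matrix.mulVec_sub, Matrix.mulVec_smul]
  simp

lemma eigenvalue_le {V : Type*} [Fintype V] [DecidableEq V]
    {G : SimpleGraph V} {α r μ : ℝ} (hα0 : 0 ≤ α) (hα1 : α < 1) {x : V → ℝ} (hx : ∀ v, 0 < x v)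
    (hMx : ∀ v, Matrix.mulVec (alphaMatrix G α) x v ≤ r * x v)
    (hμ : Module.End.HasEigenvalue (Matrix.toLin' (alphaMatrix G α)) μ) : μ ≤ r := by
  obtain ⟨K, y, v₀, hK, hy, hy0, hMy⟩ := exists_comparison hα0 hα1 hx hμ
  have h1 : 0 ≤ Matrix.mulVec (alphaMatrix G α) (fun u => K * x u - y u) v₀ := by
    rw [alphaMatrix_mulVec]
    refine Finset.sum_nonneg fun u _ => ?_
    split_ifs
    · have := hy u
      rw [hy0]
      nlinarith
    · exact le_rfl
  rw [mulVec_sub_smul] at h1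
  have h2 := hMy v₀
  rw [hy0] at h2
  have h3 := mul_le_mul_of_nonneg_left (hMx v₀) hK.le
  have h4 : 0 < K * x v₀ := mul_pos hK (hx v₀)
  by_contra! h
  nlinarith

lemma mulVec_eq_of_le_eigenvalue {V : Type*} [Fintype V] [DecidableEq V]
    {G : SimpleGraph V} {α r μ : ℝ} (hα0 : 0 ≤ α) (hα1 : α < 1) (hG : G.Connected) {x : V → ℝ} (hx : ∀ v, 0 < x v)
    (hMx : ∀ v, Matrix.mulVec (alphaMatrix G α) x v ≤ r * x v)
    (hμ : Module.End.HasEigenvalue (Matrix.toLin' (alphaMatrix G α)) μ) (hr : r ≤ μ) (v : V) :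
    Matrix.mulVec (alphaMatrix G α) x v = r * x v := by
  obtain rfl : μ = r := le_antisymm (eigenvalue_le hα0 hα1 hx hMx hμ) hr
  obtain ⟨K, y, v₀, hK, hy, hy0, hMy⟩ := exists_comparison hα0 hα1 hx hμ
  have hz : ∀ v, K * x v - y v = 0 := by
    refine eq_zero_of_mulVec_le (z := fun u => K * x u - y u) (r := μ) (v₀ := v₀) hα1 hG
      (fun v => by have := hy v; linarith) (fun v => ?_) (by linarith)
    rw [mulVec_sub_smul]
    have h2 := hMy v
    have h3 := mul_le_mul_of_nonneg_left (hMx v) hK.le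
    nlinarith
  obtain rfl : y = K • x := funext fun v => by
    have := hz v
    simp only [Pi.smul_apply, smul_eq_mul]
    linarith
  refine le_antisymm (hMx v) ?_
  have h := hMy v
  rw [Matrix.mulVec_smul] at h
  simp only [Pi.smul_apply, smul_eq_mul] at h
  refine le_of_mul_le_mul_left ?_ hK
  linarith

open Classical in
lemma exists_eigenvalue_ge {V : Type*} [Fintype V] {G : SimpleGraph V} {α r : ℝ} (hr : 0 < r)
    (h : r ≤ alphaSpectralRadius G α) :
    ∃ μ, r ≤ μ ∧ Module.End.HasEigenvalue (Matrix.toLin' (alphaMatrix G α)) μ := by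
  rw [alphaSpectralRadius] at h
  set S := {μ : ℝ | Module.End.HasEigenvalue (Matrix.toLin' (alphaMatrix G α)) μ} with hS
  have hne : S.Nonempty := by
    rw [Set.nonempty_iff_ne_empty]
    intro he
    -- The supremum of the empty set is `0`, so `0 < r` rules out an empty spectrum without appeal
    -- to symmetry.
    rw [he, Real.sSup_empty] at h
    linarith
  have hfin : S.Finite := Module.End.finite_hasEigenvalue _
  exact ⟨_, h, hne.csSup_mem hfin⟩

lemma alphaSpectralRadius_eq {V : Type*} [Fintype V] [Nonempty V] {G : SimpleGraph V} {α r : ℝ}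
    (hα0 : 0 ≤ α) (hα1 : α < 1) {x : V → ℝ} (hx : ∀ v, 0 < x v)
    (hMx : Matrix.mulVec (alphaMatrix G α) x = r • x) : alphaSpectralRadius G α = r := by
  classical
  refine IsGreatest.csSup_eq ⟨?_, fun μ hμ =>
    eigenvalue_le hα0 hα1 hx (fun v => (congrFun hMx v).le) hμ⟩
  refine Module.End.hasEigenvalue_of_hasEigenvector (x := x)
    (Module.End.hasEigenvector_iff.2 ⟨?_, ?_⟩)
  · rw [Module.End.mem_eigenspace_iff, Matrix.toLin'_apply, hMx]
  · rintro rfl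
    exact lt_irrefl _ (hx (Classical.arbitrary V))

/-- The entries of the Perron vector of `extremalGraph n`, for the eigenvalue `r`. -/
noncomputable def extremalVector (n : ℕ) (α r : ℝ) : Fin 1 ⊕ (Fin (n - 3) ⊕ Fin 2) → ℝ :=
  Sum.elim (fun _ => 1) (Sum.elim (fun _ => (1 - α) / (r - n + 4 - α)) fun _ => (1 - α) / (r - α))

lemma extremalVector_pos {n : ℕ} {α r : ℝ} (hα1 : α < 1) (hn : 4 ≤ n) (hr : (n : ℝ) - 3 < r)
    (v) : 0 < extremalVector n α r v := by
  have hn' : (4 : ℝ) ≤ n := by exact_mod_cast hn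
  rcases v with v | v | v
  · simp [extremalVector]
  · exact div_pos (by linarith) (by linarith)
  · exact div_pos (by linarith) (by linarith)

/-- The clique and leaf entries are chosen to solve their own rows; the center row, cleared of
denominators, is the cubic equation. -/
lemma extremal_mulVec {n : ℕ} {α r : ℝ} (hα1 : α < 1) (hn : 4 ≤ n) (hr : (n : ℝ) - 3 < r)
    (hc : thresholdCubic α n r = 0) :
    Matrix.mulVec (alphaMatrix (extremalGraph n) α) (extremalVector n α r)
      = r • extremalVector n α r := by
  classical
  have hn' : (4 : ℝ) ≤ n := by exact_mod_cast hn
  have h1 : r - n + 4 - α ≠ 0 := by linarith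
  have h2 : r - α ≠ 0 := by linarith
  have hcast : ((n - 3 : ℕ) : ℝ) = n - 3 := by
    rw [Nat.cast_sub (by omega)]; norm_num
  unfold thresholdCubic at hc
  ext v
  rw [alphaMatrix_mulVec, Fintype.sum_sum_type, Fintype.sum_sum_type]
  rcases v with v | v | v
  · obtain rfl : v = 0 := Subsingleton.elim _ _
    simp [extremalVector, extremalGraph, join, hcast]
    field_simp
    linear_combination -hc
  · have : ∀ u : Fin (n - 3), (if v = u then 0 else α * ((1 - α) / (r - n + 4 - α)) +
        (1 - α) * ((1 - α) / (r - n + 4 - α))) = (1 - α) / (r - n + 4 - α) -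
          if v = u then (1 - α) / (r - n + 4 - α) else 0 := by
      intro u
      by_cases h : v = u
      · simp [h]
      · simp [h]; ring
    simp [extremalVector, extremalGraph, join]
    simp only [this, Finset.sum_sub_distrib, Finset.sum_ite_eq, Finset.mem_univ, if_true]
    simp [hcast]
    field_simp
    ring
  · simp [extremalVector, extremalGraph, join]
    field_simp
    ring

lemma alphaSpectralRadius_extremalGraph {n : ℕ} {α r : ℝ} (hα0 : 0 ≤ α) (hα1 : α < 1) (hn : 4 ≤ n)
    (hr : (n : ℝ) - 3 < r) (hc : thresholdCubic α n r = 0) :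
    alphaSpectralRadius (extremalGraph n) α = r := by
  exact alphaSpectralRadius_eq hα0 hα1 (extremalVector_pos hα1 hn hr) (extremal_mulVec hα1 hn hr hc)

end Spectral

/-! ### Estimates on the root, written `r = n - 3 + e` with `b = 1 - α`. -/

section Numeric

lemma thresholdCubic_eq (α n r : ℝ) :
    thresholdCubic α n r =
      (r - α) * ((r - n + 3) * ((1 - α) * n + (r - n + 3) - 2) - 2 * α * (1 - α))
        - 2 * (1 - α) ^ 2 * ((r - n + 3) + (1 - α)) := by
  unfold thresholdCubic
  ring

/-- What the hypothesis on the order is used for. -/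
lemma order_cases {α : ℝ} {n : ℕ} (hα1 : α < 1) (heven : Even n) (hn : orderBound α ≤ n) :
    (1 / 2 ≤ 1 - α ∧ (n = 10 ∨ (12 : ℝ) ≤ n)) ∨
    (1 / 3 ≤ 1 - α ∧ 1 - α < 1 / 2 ∧ (n = 14 ∨ (16 : ℝ) ≤ n)) ∨
    (1 - α < 1 / 3 ∧ 5 ≤ (1 - α) * n) := by
  unfold orderBound at hn
  obtain ⟨k, rfl⟩ := heven
  split_ifs at hn with h1 h2
  · left
    refine ⟨by linarith, ?_⟩
    have : 10 ≤ k + k := by exact_mod_cast hn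
    by_cases h : k + k = 10
    · exact Or.inl h
    · right
      have : 12 ≤ k + k := by omega
      exact_mod_cast this
  · right; left
    refine ⟨by linarith, by linarith, ?_⟩
    have : 14 ≤ k + k := by exact_mod_cast hn
    by_cases h : k + k = 14
    · exact Or.inl h
    · right
      have : 16 ≤ k + k := by omega
      exact_mod_cast this
  · right; right
    refine ⟨by linarith, ?_⟩
    rwa [div_le_iff₀ (by linarith), mul_comm] at hn

lemma order_bounds {α : ℝ} {n : ℕ} (hα1 : α < 1) (heven : Even n) (hn : orderBound α ≤ n) :
    -- The worst case for the product is `n = 14`, `1 - α = 1 / 3`.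
    (10 : ℝ) ≤ n ∧ 14 / 3 ≤ (1 - α) * n := by
  rcases order_cases hα1 heven hn with ⟨h, rfl | h'⟩ | ⟨h, -, rfl | h'⟩ | ⟨h, h'⟩
  · norm_num; linarith
  · constructor <;> nlinarith
  · norm_num; linarith
  · constructor <;> nlinarith
  · constructor <;> nlinarith

lemma root_identity {b n e : ℝ} (hc : thresholdCubic (1 - b) n (n - 3 + e) = 0) :
    e * (b * n + e - 2) * (n - 4 + b + e) =
      2 * (1 - b) * b * (n - 4 + b + e) + 2 * b ^ 2 * (e + b) := by
  rw [thresholdCubic_eq] at hc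
  linear_combination hc

lemma root_lt {b n e : ℝ} (hb0 : 0 < b) (hb1 : b ≤ 1) (hn : 10 ≤ n) (hbn : 14 / 3 ≤ b * n)
    (hc : thresholdCubic (1 - b) n (n - 3 + e) = 0) : e < 1 := by
  have h := root_identity hc
  by_contra! he
  have hY : 6 < n - 4 + b + e := by linarith
  have h1 : 2 * (1 - b) * b ≤ 1 / 2 := by nlinarith [sq_nonneg (2 * b - 1)]
  have h2 : 2 * b ^ 2 * (e + b) ≤ 2 * (e + 1) := by
    have : b ^ 2 ≤ 1 := by nlinarith
    nlinarith
  have h3 : e * (8 / 3) ≤ e * (b * n + e - 2) := by nlinarith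
  have h4 : e * (8 / 3) * (n - 4 + b + e) ≤ e * (b * n + e - 2) * (n - 4 + b + e) := by
    nlinarith
  have h5 : 2 * (1 - b) * b * (n - 4 + b + e) ≤ 1 / 2 * (n - 4 + b + e) := by nlinarith
  nlinarith

lemma root_mul_lower {b n e : ℝ} (hb0 : 0 < b) (hn : 10 ≤ n) (he0 : 0 < e)
    (hc : thresholdCubic (1 - b) n (n - 3 + e) = 0) :
    2 * (1 - b) * b ≤ e * (b * n + e - 2) := by
  have h := root_identity hc
  have hY : 0 < n - 4 + b + e := by linarith
  have : 0 < 2 * b ^ 2 * (e + b) := by positivity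
  refine le_of_mul_le_mul_right ?_ hY
  linarith

/-- This is the largest separator, `s = (n - 2) / 2`, where all parts are singletons. The terms free
of `e` suffice except for `n = 10` and `n = 14` with small `1 - α`, where a lower bound on `e` is
needed. -/
lemma endpoint_ineq {α e : ℝ} {n : ℕ} (hα0 : 0 ≤ α) (hα1 : α < 1) (heven : Even n)
    (hn : orderBound α ≤ n) (he0 : 0 < e) (he1 : e < 1)
    (hc : thresholdCubic α n (n - 3 + e) = 0) :
    0 < (1 - α) * (n ^ 2 - 6 * n) - 4 * (n - 4) + 2 * e * (n - 8 + 2 * ((1 - α) * n))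
      + 4 * e ^ 2 := by
  obtain ⟨hn10, hbn⟩ := order_bounds hα1 heven hn
  obtain ⟨b, rfl⟩ : ∃ b, α = 1 - b := ⟨1 - α, by ring⟩
  have hI := root_identity hc
  have hL := root_mul_lower (by linarith) hn10 he0 hc
  have hb : 1 - (1 - b) = b := by ring
  have hE : 0 < 2 * e * (n - 8 + 2 * (b * n)) := by
    have : 0 < (n : ℝ) - 8 + 2 * (b * n) := by rw [hb] at hbn; linarith
    positivity
  have hcase := order_cases hα1 heven hn
  rw [hb] at *
  rcases hcase with ⟨h, rfl | h'⟩ | ⟨h, h3, rfl | h'⟩ | ⟨h, h'⟩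
  · norm_num at *
    by_cases hb6 : 3 / 5 ≤ b
    · nlinarith
    · push Not at hb6
      -- The deficit of the terms free of `e` is `24 - 40 b = 24 (1 - 5 b / 3)`, while `b ≥ 1 / 2`
      -- makes the linear term at least `24 e`.
      have : 1 - 5 / 3 * b ≤ e := by
        by_contra! hlt
        have h1 : e * (b * 10 + e - 2) ≤ (1 - 5 / 3 * b) * (b * 10 + (1 - 5 / 3 * b) - 2) := by
          nlinarith
        have h6 : 2 * b ^ 2 * (e + b) = (e * (b * 10 + e - 2) - 2 * (1 - b) * b) * (6 + b + e) := by
          linear_combination -hI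
        have h7 : 2 * b ^ 3 ≤ ((1 - 5 / 3 * b) * (b * 10 + (1 - 5 / 3 * b) - 2) - 2 * (1 - b) * b) * 7 := by
          have : 2 * b ^ 2 * b ≤ 2 * b ^ 2 * (e + b) := by
            apply mul_le_mul_of_nonneg_left <;> nlinarith
          nlinarith
        nlinarith [mul_nonneg (sub_nonneg.2 h) (sq_nonneg (b - 1 / 2))]
      nlinarith
  · have : 0 ≤ ((n : ℝ) - 12) * (n - 2) + 8 := by nlinarith
    nlinarith
  · norm_num at *
    by_cases hb6 : 5 / 14 ≤ b
    · nlinarith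
    · push Not at hb6
      have : 1 / 10 ≤ e := by
        by_contra! hlt
        nlinarith
      nlinarith
  · nlinarith
  · nlinarith

/-- At `s = 1` the two sides agree by the cubic, so `s - 1` divides their difference. The quotient
is a quadratic in `s` that does not increase on `[1, (n - 2) / 2]`, so its sign is decided at the
right endpoint. -/
lemma join_poly_pos {α e s : ℝ} {n : ℕ} (hα0 : 0 ≤ α) (hα1 : α < 1) (heven : Even n)
    (hn : orderBound α ≤ n) (he0 : 0 < e) (he1 : e < 1)
    (hc : thresholdCubic α n (n - 3 + e) = 0) (hs : 1 < s) (hsn : 2 * s + 2 ≤ n) :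
    (1 - α) ^ 2 * s * ((s + 1) * (e - 1 + (2 - α) * s) + (n - 1 - 2 * s) * (n - 3 + e - α * s)) <
    ((1 - α) * n + e - 2 - (1 - α) * s) * (n - 3 + e - α * s) * (e - 1 + (2 - α) * s) := by
  have hend := endpoint_ineq hα0 hα1 heven hn he0 he1 hc
  obtain ⟨hn10, hbn⟩ := order_bounds hα1 heven hn
  obtain ⟨b, rfl⟩ : ∃ b, α = 1 - b := ⟨1 - α, by ring⟩
  have hI := root_identity hc
  have hb : 1 - (1 - b) = b := by ring
  rw [hb] at hend hbn ⊢
  clear hn heven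
  generalize (n : ℝ) = N at *
  set q1 := -2 * (1 - b) * b * (N - 4 + b + e) - 2 * b ^ 2 * (e + b) + (1 - b) * (2 - 3 * b)
    - (1 - b) ^ 2 * e - b ^ 2 * (1 - e) with hq1
  set q2 := b * (1 - 3 * b) with hq2
  set q0 := (b * N + e - 2) * (N - 3 + e) * (1 - e) with hq0
  have hb0 : 0 < b := by linarith
  have hq1n : q1 ≤ (1 - b) * (2 + 5 * b - 2 * (b * N)) := by
    have h1 : 0 ≤ (1 - b) * b * e := by positivity
    have h2 : 0 ≤ b ^ 2 * (e + b) := by positivity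
    have h3 : 0 ≤ (1 - b) ^ 2 * e := by positivity
    have h4 : 0 ≤ b ^ 2 * (1 - e) := mul_nonneg (by positivity) (by linarith)
    have h5 : 0 ≤ (1 - b) * b * b := by positivity
    rw [hq1]
    nlinarith
  have hA : q1 ≤ 0 := hq1n.trans (mul_nonpos_of_nonneg_of_nonpos (by linarith) (by nlinarith))
  have hB : q1 + q2 * (N - 2) ≤ 0 := by
    by_cases h3 : b ≤ 1 / 3
    · rw [hq2]
      nlinarith [mul_nonneg hb0.le (sub_nonneg.2 hbn), mul_nonneg hb0.le (sub_nonneg.2 h3)]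
    · push Not at h3
      have : q2 * (N - 2) ≤ 0 :=
        mul_nonpos_of_nonpos_of_nonneg (by rw [hq2]; nlinarith) (by linarith)
      linarith
  -- This is the slope of the quadratic's secant between two points with sum `t`; being affine in
  -- `t`, it needs checking only at the ends.
  have hAB : ∀ t, 0 ≤ t → t ≤ N - 2 → q1 + q2 * t ≤ 0 := by
    intro t ht0 ht
    by_cases h : 0 ≤ q2
    · linarith [mul_le_mul_of_nonneg_left ht h]
    · push Not at h
      linarith [mul_nonpos_of_nonpos_of_nonneg h.le ht0]
  have key : ∀ t : ℝ, (b * N + e - 2 - b * t) * (N - 3 + e - (1 - b) * t) * (e - 1 + (2 - (1 - b)) * t)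
      - b ^ 2 * t * ((t + 1) * (e - 1 + (2 - (1 - b)) * t) + (N - 1 - 2 * t) * (N - 3 + e - (1 - b) * t))
      = (t - 1) * (q2 * t ^ 2 + q1 * t + q0) := by
    intro t
    rw [hq2, hq1, hq0]
    linear_combination t * hI
  have hQend : 0 < q2 * ((N - 2) / 2) ^ 2 + q1 * ((N - 2) / 2) + q0 := by
    have hk := key ((N - 2) / 2)
    -- At this endpoint the last two factors of the product coincide, and one copy cancels.
    have hpos : 0 < (N - 3 + e - (1 - b) * ((N - 2) / 2)) := by
      have := mul_nonneg hb0.le (show 0 ≤ N - 2 by linarith)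
      linarith
    have : 0 < ((N - 2) / 2 - 1) * (q2 * ((N - 2) / 2) ^ 2 + q1 * ((N - 2) / 2) + q0) := by
      rw [← hk]
      have := mul_pos hpos hend
      linarith
    exact (mul_pos_iff_of_pos_left (by linarith)).1 this
  have hmono : 0 ≤ ((N - 2) / 2 - s) * (-(q1 + q2 * (s + (N - 2) / 2))) :=
    mul_nonneg (by linarith) (by linarith [hAB (s + (N - 2) / 2) (by linarith) (by linarith)])
  have hQ : 0 < q2 * s ^ 2 + q1 * s + q0 := by linarith
  have := mul_pos (sub_pos.2 hs) hQ
  rw [← key s] at this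
  linarith

end Numeric

/-! ### The test vector on a partitioned graph, and the equality case. -/

section Partition

/-- With `c = r - α s + 1` and `m = n - 2 s - 1`, this is the row inequality at a vertex of the
clique `K_s` of `K_s ∇ (K_m ∪ (s + 1) K₁)`. -/
lemma center_row_bound {α r s c m : ℝ} {n : ℕ} (hα0 : 0 ≤ α) (hα1 : α < 1) (heven : Even n)
    (hn : orderBound α ≤ n) (hr : (n : ℝ) - 3 < r) (hroot : thresholdCubic α n r = 0)
    (hs : 1 ≤ s) (hsn : 2 * s + 2 ≤ n) (hc : c = r - α * s + 1) (hm : m = n - 2 * s - 1) :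
    s - 1 + α * (n - s) + (1 - α) ^ 2 * s * ((c * (n - s) - (s + 2) * m) / ((c - m) * (c - 1))) ≤ r
    ∧ (s - 1 + α * (n - s) +
        (1 - α) ^ 2 * s * ((c * (n - s) - (s + 2) * m) / ((c - m) * (c - 1))) = r → s = 1) := by
  obtain ⟨hn10, hbn⟩ := order_bounds hα1 heven hn
  obtain ⟨e, rfl⟩ : ∃ e, r = n - 3 + e := ⟨r - n + 3, by ring⟩
  have he0 : 0 < e := by linarith
  have he1 : e < 1 := by
    refine root_lt (b := 1 - α) (n := n) (by linarith) (by linarith) hn10 hbn ?_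
    rwa [sub_sub_cancel]
  have hαs : α * s ≤ s := by nlinarith
  have hcm : 0 < c - m := by rw [hc, hm]; linarith
  have hc1 : 0 < c - 1 := by rw [hm] at hcm; linarith
  have hD : 0 < (c - m) * (c - 1) := mul_pos hcm hc1
  rcases hs.eq_or_lt with rfl | hs
  · refine ⟨le_of_eq ?_, fun _ => rfl⟩
    rw [thresholdCubic_eq] at hroot
    field_simp
    rw [hc, hm]
    linear_combination -hroot
  · have h := join_poly_pos hα0 hα1 heven hn he0 he1 hroot hs hsn
    have hlt : s - 1 + α * (n - s) +
        (1 - α) ^ 2 * s * ((c * (n - s) - (s + 2) * m) / ((c - m) * (c - 1))) < n - 3 + e := by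
      rw [← lt_sub_iff_add_lt', ← mul_div_assoc, div_lt_iff₀ hD, hc, hm]
      linarith
    exact ⟨hlt.le, fun h => absurd h hlt.ne⟩

/-- Convexity of `k / (c - k)`: the right side is the chord over `[1, m]`, and the gap has the
factor `(k - 1) * (m - k)`. -/
lemma div_sub_le_chord {c m k : ℝ} (hk1 : 1 ≤ k) (hkm : k ≤ m) (hmc : m < c) :
    k / (c - k) ≤ -m / ((c - m) * (c - 1)) + c / ((c - m) * (c - 1)) * k ∧
    (k / (c - k) = -m / ((c - m) * (c - 1)) + c / ((c - m) * (c - 1)) * k → k = 1 ∨ k = m) := by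
  have h1 : 0 < c - 1 := by linarith
  have h2 : 0 < c - m := by linarith
  have h3 : 0 < c - k := by linarith
  have hc : 0 < c := by linarith
  have key : -m / ((c - m) * (c - 1)) + c / ((c - m) * (c - 1)) * k - k / (c - k)
      = c * ((k - 1) * (m - k)) / ((c - m) * (c - 1) * (c - k)) := by
    field_simp
    ring
  have hnn : 0 ≤ (k - 1) * (m - k) := mul_nonneg (by linarith) (by linarith)
  constructor
  · rw [← sub_nonneg, key]
    positivity
  · intro h
    rw [h, sub_self, eq_comm, div_eq_zero_iff] at key
    rcases key with key | key
    · rcases mul_eq_zero.1 ((mul_eq_zero.1 key).resolve_left hc.ne') with h | h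
      · left; linarith
      · right; linarith
    · exact absurd key (by positivity)

open Classical in
/-- The number of vertices labelled `o`. -/
noncomputable def fiberCard {V ι : Type*} [Fintype V] (κ : V → Option ι) (o : Option ι) : ℕ :=
  (Finset.univ.filter fun v => κ v = o).card

/-- The adjacency condition for distinct vertices in the graph obtained from disjoint cliques, one for
each `i : ι`, by joining them all to the clique of the vertices labelled `none`. -/
def Related {V ι : Type*} (κ : V → Option ι) (v u : V) : Prop :=
  κ v = none ∨ κ u = none ∨ κ v = κ u

lemma sum_comp_label {V ι : Type*} [Fintype V] [Fintype ι] (κ : V → Option ι) (F : Option ι → ℝ) :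
    ∑ u, F (κ u) = fiberCard κ none * F none + ∑ i, fiberCard κ (some i) * F (some i) := by
  classical
  have h := Finset.sum_fiberwise (Finset.univ : Finset V) κ (fun u => F (κ u))
  rw [← h, Fintype.sum_option]
  have : ∀ o, ∑ u with κ u = o, F (κ u) = fiberCard κ o * F o := by
    intro o
    rw [Finset.sum_congr rfl (g := fun _ => F o) (fun u hu => by rw [(Finset.mem_filter.1 hu).2])]
    rw [Finset.sum_const, nsmul_eq_mul, fiberCard]
  simp only [this]

lemma fiberCard_add_sum {V ι : Type*} [Fintype V] [Fintype ι] (κ : V → Option ι) :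
    fiberCard κ none + ∑ i, fiberCard κ (some i) = Fintype.card V := by
  have h := sum_comp_label κ (fun _ => 1)
  simp only [Finset.sum_const, Finset.card_univ, nsmul_eq_mul, mul_one] at h
  exact_mod_cast h.symm

lemma fiberCard_pos {V ι : Type*} [Fintype V] {κ : V → Option ι} {v : V} {o : Option ι} (h : κ v = o) :
    1 ≤ fiberCard κ o :=
  Finset.card_pos.2 ⟨v, by simp [h]⟩

lemma fiberCard_add_card_le {V ι : Type*} [Fintype V] [Fintype ι] {κ : V → Option ι} (hκ : ∀ i, ∃ v, κ v = some i) (i : ι) :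
    fiberCard κ none + fiberCard κ (some i) + Fintype.card ι ≤ Fintype.card V + 1 := by
  classical
  have h := fiberCard_add_sum κ
  rw [← Finset.add_sum_erase _ _ (Finset.mem_univ i)] at h
  have h2 : (Finset.univ.erase i).card • 1 ≤ ∑ j ∈ Finset.univ.erase i, fiberCard κ (some j) :=
    Finset.card_nsmul_le_sum _ _ _ fun j _ => (hκ j).elim fun v hv => fiberCard_pos hv
  rw [Finset.card_erase_of_mem (Finset.mem_univ i), Finset.card_univ, smul_eq_mul, mul_one] at h2
  omega

-- A row of `A_α` sums positive terms over the neighbours, so extra edges strictly increase it. The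
-- subtracted `x v` is the term `u = v`, present because `Related` is reflexive.
open Classical in
lemma mulVec_le_related {V ι : Type*} [Fintype V] {G : SimpleGraph V} {κ : V → Option ι} {α : ℝ}
    (hα0 : 0 ≤ α) (hα1 : α < 1)
    (hadj : ∀ v u, G.Adj v u → Related κ v u) {x : V → ℝ} (hx : ∀ v, 0 < x v) (v : V) :
    Matrix.mulVec (alphaMatrix G α) x v ≤
        (∑ u, if Related κ v u then α * x v + (1 - α) * x u else 0) - x v ∧
      (Matrix.mulVec (alphaMatrix G α) x v =
        (∑ u, if Related κ v u then α * x v + (1 - α) * x u else 0) - x v →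
          ∀ u, v ≠ u → Related κ v u → G.Adj v u) := by
  have hpos : ∀ u, 0 < α * x v + (1 - α) * x u := fun u =>
    add_pos_of_nonneg_of_pos (mul_nonneg hα0 (hx v).le) (mul_pos (by linarith) (hx u))
  have hsum : (∑ u, if Related κ v u then α * x v + (1 - α) * x u else 0) - x v =
      ∑ u, if v ≠ u ∧ Related κ v u then α * x v + (1 - α) * x u else 0 := by
    have : x v = ∑ u, if v = u then x v else 0 := by simp
    conv_lhs => rw [this]
    rw [← Finset.sum_sub_distrib]
    refine Finset.sum_congr rfl fun u _ => ?_
    by_cases h : v = u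
    · subst h
      have : Related κ v v := Or.inr (Or.inr rfl)
      simp [this]
      ring
    · simp [h]
  rw [hsum, alphaMatrix_mulVec]
  have hle : ∀ u ∈ Finset.univ, (if G.Adj v u then α * x v + (1 - α) * x u else 0) ≤
      if v ≠ u ∧ Related κ v u then α * x v + (1 - α) * x u else 0 := by
    intro u _
    by_cases h : G.Adj v u
    · rw [if_pos h, if_pos ⟨h.ne, hadj _ _ h⟩]
    · rw [if_neg h]
      split_ifs
      · exact (hpos u).le
      · exact le_rfl
  refine ⟨Finset.sum_le_sum hle, fun h u hne hR => ?_⟩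
  have := (Finset.sum_eq_sum_iff_of_le hle).1 h u (Finset.mem_univ _)
  by_contra hA
  rw [if_neg hA, if_pos (show v ≠ u ∧ Related κ v u from ⟨hne, hR⟩)] at this
  exact (hpos u).ne this

/-- A partition of a connected graph of large `A_α`-spectral radius into a separator (label `none`) and
at least two more parts than the separator has vertices is that of the extremal graph. -/
theorem partition_of_le_alphaSpectralRadius {V ι : Type*} [Fintype V] [Fintype ι]
    {G : SimpleGraph V} {κ : V → Option ι} {α r : ℝ} {n : ℕ}
    (hα0 : 0 ≤ α) (hα1 : α < 1) (hcard : Fintype.card V = n) (heven : Even n)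
    (hn : orderBound α ≤ n) (hr : (n : ℝ) - 3 < r) (hroot : thresholdCubic α n r = 0)
    (hG : G.Connected) (hadj : ∀ v u, G.Adj v u → Related κ v u) (hκ : ∀ i, ∃ v, κ v = some i)
    (hparts : fiberCard κ none + 2 ≤ Fintype.card ι) (hspec : r ≤ alphaSpectralRadius G α) :
    fiberCard κ none = 1 ∧ Fintype.card ι = 3 ∧
      (∀ i, fiberCard κ (some i) = 1 ∨ fiberCard κ (some i) = n - 3) ∧
      ∀ v u, G.Adj v u ↔ v ≠ u ∧ Related κ v u := by
  classical
  obtain ⟨hn10, hbn⟩ := order_bounds hα1 heven hn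
  -- With an empty separator labels would be constant along walks, against connectedness.
  have hs1 : ∃ v₀, κ v₀ = none := by
    by_contra! hno
    have hstep : ∀ v u, G.Walk v u → κ v = κ u := by
      intro v u p
      induction p with
      | nil => rfl
      | cons h _ ih => exact (((hadj _ _ h).resolve_left (hno _)).resolve_left (hno _)).trans ih
    obtain ⟨i, j, hij⟩ := Fintype.exists_pair_of_one_lt_card (show 1 < Fintype.card ι by omega)
    obtain ⟨v, hv⟩ := hκ i
    obtain ⟨u, hu⟩ := hκ j
    obtain ⟨p⟩ := hG.preconnected v u
    have := hstep v u p
    rw [hv, hu] at this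
    exact hij (Option.some_injective _ this)
  obtain ⟨v₀, hv₀⟩ := hs1
  have hs := fiberCard_pos hv₀
  have htot := fiberCard_add_sum κ
  have htotR : (fiberCard κ none : ℝ) + ∑ i, (fiberCard κ (some i) : ℝ) = n := by
    rw [← hcard, ← htot]; push_cast; rfl
  have hk1 : ∀ i, 1 ≤ fiberCard κ (some i) := fun i => (hκ i).elim fun v hv => fiberCard_pos hv
  have hkm : ∀ i, fiberCard κ (some i) + 2 * fiberCard κ none + 1 ≤ n := fun i => by
    have := fiberCard_add_card_le hκ i
    omega
  obtain ⟨i₀⟩ : Nonempty ι := Fintype.card_pos_iff.1 (by omega)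
  have hsn : 2 * fiberCard κ none + 2 ≤ n := by
    have := hkm i₀
    have := hk1 i₀
    omega
  obtain ⟨k, hk⟩ : ∃ k : ι → ℝ, k = fun i => (fiberCard κ (some i) : ℝ) := ⟨_, rfl⟩
  obtain ⟨s, hsdef⟩ : ∃ s : ℝ, s = fiberCard κ none := ⟨_, rfl⟩
  have hsR : 1 ≤ s := by rw [hsdef]; exact_mod_cast hs
  have hsnR : 2 * s + 2 ≤ n := by rw [hsdef]; exact_mod_cast hsn
  obtain ⟨c, hc⟩ : ∃ c, c = r - α * s + 1 := ⟨_, rfl⟩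
  obtain ⟨m, hm⟩ : ∃ m, m = (n : ℝ) - 2 * s - 1 := ⟨_, rfl⟩
  have hk1R : ∀ i, 1 ≤ k i := fun i => by simpa [hk] using hk1 i
  have hkmR : ∀ i, k i ≤ m := fun i => by
    have : (fiberCard κ (some i) : ℝ) + 2 * fiberCard κ none + 1 ≤ n := by exact_mod_cast hkm i
    rw [hk, hm, hsdef]
    simp only
    linarith
  have hsumk : ∑ i, k i = n - s := by rw [hk, hsdef]; simp only; linarith
  have hαs : α * s ≤ s := by nlinarith
  have hmc : m < c := by rw [hc, hm]; linarith
  have hck : ∀ i, 0 < c - k i := fun i => by linarith [hkmR i]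
  -- The row of a vertex in part `i` reads `s (α w + 1 - α) + (k i - 1) w = r w`; this is its
  -- solution.
  obtain ⟨w, hw⟩ : ∃ w : Option ι → ℝ, w = fun o => o.elim 1 fun i => (1 - α) * s / (c - k i) := ⟨_, rfl⟩
  have hw0 : w none = 1 := by rw [hw]; rfl
  have hwi : ∀ i, w (some i) = (1 - α) * s / (c - k i) := fun i => by rw [hw]; rfl
  have hwpos : ∀ o, 0 < w o := by
    rintro (_ | i)
    · rw [hw0]; exact one_pos
    · rw [hwi]
      exact div_pos (mul_pos (by linarith) (by linarith)) (hck i)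
  have hchord := fun i => div_sub_le_chord (hk1R i) (hkmR i) hmc
  obtain ⟨hcenter, hcenter_eq⟩ := center_row_bound hα0 hα1 heven hn hr hroot hsR hsnR hc hm
  set A := -m / ((c - m) * (c - 1)) with hA
  set B := c / ((c - m) * (c - 1)) with hB
  have hm1 : 1 ≤ m := by linarith
  have hD : 0 < (c - m) * (c - 1) := mul_pos (by linarith) (by linarith)
  have hAneg : A < 0 := div_neg_of_neg_of_pos (by linarith) hD
  have hAB : (c * (n - s) - (s + 2) * m) / ((c - m) * (c - 1)) = (s + 2) * A + B * (n - s) := by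
    rw [hA, hB]; ring
  have htR : s + 2 ≤ (Fintype.card ι : ℝ) := by rw [hsdef]; exact_mod_cast hparts
  have hsumchord : ∑ i, (A + B * k i) = Fintype.card ι * A + B * (n - s) := by
    rw [Finset.sum_add_distrib, ← Finset.mul_sum, hsumk]
    simp
  have hle1 : ∑ i, k i / (c - k i) ≤ ∑ i, (A + B * k i) := Finset.sum_le_sum fun i _ => (hchord i).1
  -- The chord has negative intercept `A`, so parts beyond `s + 2` only lower the sum.
  have hle2 : ∑ i, (A + B * k i) ≤ (s + 2) * A + B * (n - s) := by
    rw [hsumchord]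
    nlinarith
  have hrowsome : ∀ v i, κ v = some i →
      (∑ u, if Related κ v u then α * w (κ v) + (1 - α) * w (κ u) else 0) - w (κ v)
        = r * w (κ v) := by
    intro v i hv
    have h := sum_comp_label κ (fun o => if o = none ∨ some i = o then
      α * w (some i) + (1 - α) * w o else 0)
    simp only [Related, hv, reduceCtorEq, false_or]
    rw [h]
    simp only [true_or, if_true, reduceCtorEq, false_or, Option.some.injEq, mul_ite, mul_zero,
      Finset.sum_ite_eq, Finset.mem_univ]
    rw [hw0, hwi, ← hsdef]
    have hki : (fiberCard κ (some i) : ℝ) = k i := by rw [hk]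
    rw [hki]
    have := (hck i).ne'
    field_simp
    rw [hc]
    ring
  have hrownone : ∀ v, κ v = none →
      (∑ u, if Related κ v u then α * w (κ v) + (1 - α) * w (κ u) else 0) - w (κ v)
        = s - 1 + α * (n - s) + (1 - α) ^ 2 * s * ∑ i, k i / (c - k i) := by
    intro v hv
    have h := sum_comp_label κ (fun o => α * w none + (1 - α) * w o)
    simp only [Related, hv, true_or, if_true]
    rw [h, hw0, ← hsdef, ← hsumk, Finset.mul_sum, Finset.mul_sum]
    have : ∀ i, (fiberCard κ (some i) : ℝ) * (α * 1 + (1 - α) * w (some i)) =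
        α * k i + (1 - α) ^ 2 * s * (k i / (c - k i)) := by
      intro i
      rw [hwi, hk]
      ring
    simp only [this, Finset.sum_add_distrib]
    ring
  have hcoef : 0 < (1 - α) ^ 2 * s := mul_pos (pow_pos (by linarith) 2) (by linarith)
  rw [hAB] at hcenter hcenter_eq
  have hrow : ∀ v, (∑ u, if Related κ v u then α * w (κ v) + (1 - α) * w (κ u) else 0) - w (κ v)
      ≤ r * w (κ v) := by
    intro v
    rcases hv : κ v with _ | i
    · rw [← hv, hrownone v hv, hv, hw0, mul_one]
      have := mul_le_mul_of_nonneg_left (hle1.trans hle2) hcoef.le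
      linarith
    · rw [← hv]
      exact (hrowsome v i hv).le
  have hcmp := fun v => mulVec_le_related hα0 hα1 hadj (x := fun v => w (κ v)) (fun v => hwpos _) v
  obtain ⟨μ, hrμ, hμ⟩ := exists_eigenvalue_ge (by linarith) hspec
  have heq := mulVec_eq_of_le_eigenvalue hα0 hα1 hG (x := fun v => w (κ v)) (fun v => hwpos _)
    (fun v => (hcmp v).1.trans (hrow v)) hμ hrμ
  have heqrow : ∀ v,
      (∑ u, if Related κ v u then α * w (κ v) + (1 - α) * w (κ u) else 0) - w (κ v) = r * w (κ v) :=
    fun v => le_antisymm (hrow v) ((heq v).symm.le.trans (hcmp v).1)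
  have h0 := heqrow v₀
  rw [hrownone v₀ hv₀, hv₀, hw0, mul_one] at h0
  have hle := mul_le_mul_of_nonneg_left (hle1.trans hle2) hcoef.le
  have hs_eq : s = 1 := hcenter_eq (by linarith)
  have hsum_eq : ∑ i, k i / (c - k i) = (s + 2) * A + B * (n - s) := by
    refine mul_left_cancel₀ hcoef.ne' ?_
    linarith
  have hsn1 : fiberCard κ none = 1 := by rw [hsdef] at hs_eq; exact_mod_cast hs_eq
  refine ⟨hsn1, ?_, fun i => ?_, fun v u => ⟨fun h => ⟨h.ne, hadj v u h⟩, fun h => ?_⟩⟩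
  · have h1 : ((Fintype.card ι : ℝ) - (s + 2)) * A = 0 := by linarith
    have h2 := (mul_eq_zero.1 h1).resolve_right hAneg.ne
    have h3 : (Fintype.card ι : ℝ) = 3 := by linarith
    exact_mod_cast h3
  · have h1 := (Finset.sum_eq_sum_iff_of_le fun i _ => (hchord i).1).1
      (le_antisymm hle1 (hle2.trans hsum_eq.ge)) i (Finset.mem_univ _)
    rcases (hchord i).2 h1 with h | h
    · left
      simpa [hk] using h
    · right
      have h2 : (fiberCard κ (some i) : ℝ) + 3 = n := by
        rw [hk] at h
        simp only at h
        linarith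
      have h3 : fiberCard κ (some i) + 3 = n := by exact_mod_cast h2
      omega
  · exact (hcmp v).2 ((heq v).trans (heqrow v).symm) u h.1 h.2

end Partition

/-! ### Recognizing the extremal graph, and its lack of a perfect matching. -/

section Extremal

/-- The three kinds of vertices of `extremalGraph n`: center, clique, leaf. -/
def extremalKind (n : ℕ) : Fin 1 ⊕ (Fin (n - 3) ⊕ Fin 2) → Fin 3 :=
  Sum.elim (fun _ => 0) (Sum.elim (fun _ => 1) fun _ => 2)

lemma extremalGraph_adj {n : ℕ} (v u : Fin 1 ⊕ (Fin (n - 3) ⊕ Fin 2)) :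
    (extremalGraph n).Adj v u ↔ v ≠ u ∧ (extremalKind n v = 0 ∨ extremalKind n u = 0 ∨
      (extremalKind n v = 1 ∧ extremalKind n u = 1)) := by
  rcases v with v | v | v <;> rcases u with u | u | u <;>
    simp [extremalGraph, join, extremalKind]

lemma card_extremalKind (n : ℕ) (c : Fin 3) :
    Fintype.card {v // extremalKind n v = c} = ![1, n - 3, 2] c := by
  rw [Fintype.card_subtype, Finset.card_filter, Fintype.sum_sum_type, Fintype.sum_sum_type]
  fin_cases c <;> simp [extremalKind]

lemma nonempty_iso_extremalGraph {V : Type*} [Fintype V] {G : SimpleGraph V} {n : ℕ} (τ : V → Fin 3)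
    (hτ : ∀ c, Nat.card {v // τ v = c} = ![1, n - 3, 2] c)
    (hadj : ∀ v u, G.Adj v u ↔ v ≠ u ∧ (τ v = 0 ∨ τ u = 0 ∨ (τ v = 1 ∧ τ u = 1))) :
    Nonempty (G ≃g extremalGraph n) := by
  classical
  have e : ∀ c, {v // τ v = c} ≃ {v // extremalKind n v = c} := fun c =>
    Fintype.equivOfCardEq (by rw [card_extremalKind, ← hτ, Nat.card_eq_fintype_card])
  refine ⟨⟨Equiv.ofFiberEquiv e, @fun v u => ?_⟩⟩
  have h : ∀ w, extremalKind n (Equiv.ofFiberEquiv e w) = τ w := Equiv.ofFiberEquiv_map e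
  rw [extremalGraph_adj, hadj, h, h]
  exact and_congr_left' (Equiv.ofFiberEquiv e).injective.ne_iff

lemma nonempty_iso_of_partition {V ι : Type*} [Fintype V] [Fintype ι] {G : SimpleGraph V}
    {κ : V → Option ι} {n : ℕ} (hn : 6 ≤ n) (hcard : Fintype.card V = n)
    (hs : fiberCard κ none = 1) (ht : Fintype.card ι = 3)
    (hk : ∀ i, fiberCard κ (some i) = 1 ∨ fiberCard κ (some i) = n - 3)
    (hadj : ∀ v u, G.Adj v u ↔ v ≠ u ∧ Related κ v u) :
    Nonempty (G ≃g extremalGraph n) := by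
  classical
  have htot := fiberCard_add_sum κ
  -- Exactly one part is large: with none the order would be `4`, with two it would exceed `n`.
  obtain ⟨i₀, hi₀⟩ : ∃ i, fiberCard κ (some i) = n - 3 := by
    by_contra! h
    have h1 : ∀ i, fiberCard κ (some i) = 1 := fun i => (hk i).resolve_right (h i)
    simp only [h1, Finset.sum_const, Finset.card_univ, smul_eq_mul, mul_one] at htot
    omega
  have hone : ∀ i, i ≠ i₀ → fiberCard κ (some i) = 1 := by
    intro i hi
    refine (hk i).resolve_right fun h => ?_
    rw [← Finset.add_sum_erase _ _ (Finset.mem_univ i₀), ← Finset.add_sum_erase _ _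
      (Finset.mem_erase.2 ⟨hi, Finset.mem_univ i⟩)] at htot
    omega
  have hfiber : ∀ o, Nat.card {v // κ v = o} = fiberCard κ o := by
    intro o
    rw [Nat.card_eq_fintype_card, Fintype.card_subtype, fiberCard]
  let τ : V → Fin 3 := fun v => if κ v = none then 0 else if κ v = some i₀ then 1 else 2
  have h0 : ∀ v, τ v = 0 ↔ κ v = none := by
    intro v
    simp only [τ]
    split_ifs <;> simp_all
  have h1 : ∀ v, τ v = 1 ↔ κ v = some i₀ := by
    intro v
    simp only [τ]
    split_ifs <;> simp_all
  have c0 : Nat.card {v // τ v = 0} = 1 := by simp only [h0, hfiber, hs]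
  have c1 : Nat.card {v // τ v = 1} = n - 3 := by simp only [h1, hfiber, hi₀]
  have c2 : Nat.card {v // τ v = 2} = 2 := by
    have h := Fintype.card_congr (Equiv.sigmaFiberEquiv τ)
    rw [Fintype.card_sigma, Fin.sum_univ_three, hcard] at h
    simp only [Nat.card_eq_fintype_card] at c0 c1 ⊢
    omega
  refine nonempty_iso_extremalGraph τ (fun c => ?_) fun v u => ?_
  · fin_cases c
    · exact c0
    · exact c1
    · exact c2
  · rw [hadj, and_congr_right_iff]
    intro hne
    rw [h0, h0, h1, h1, Related]
    refine or_congr_right' fun hv => or_congr_right' fun hu => ⟨fun h => ?_, fun h => h.1.trans h.2.symm⟩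
    obtain ⟨i, hi⟩ := Option.ne_none_iff_exists'.1 hv
    have hui : κ u = some i := h ▸ hi
    by_cases hii : i = i₀
    · subst hii
      exact ⟨hi, hui⟩
    · exact absurd (Finset.card_le_one.1 (hone i hii).le v (by simp [hi]) u (by simp [hui])) hne

/-- Both leaves could only be matched to the center. -/
lemma not_isPerfectMatching_of_iso {V : Type*} {G : SimpleGraph V} {n : ℕ} (φ : G ≃g extremalGraph n)
    (M : G.Subgraph) : ¬ M.IsPerfectMatching := by
  intro hM
  have h : ∀ j : Fin 2, M.Adj (φ.symm (Sum.inr (Sum.inr j))) (φ.symm (Sum.inl 0)) := by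
    intro j
    obtain ⟨w, hw, -⟩ := Subgraph.isPerfectMatching_iff.1 hM (φ.symm (Sum.inr (Sum.inr j)))
    have hadj := φ.map_adj_iff.2 hw.adj_sub
    rw [RelIso.apply_symm_apply, extremalGraph_adj] at hadj
    have : w = φ.symm (Sum.inl 0) := by
      rw [RelIso.eq_symm_apply]
      rcases hφ : φ w with a | a | a
      · rw [Subsingleton.elim a 0]
      · rw [hφ] at hadj; simp [extremalKind] at hadj
      · rw [hφ] at hadj; simp [extremalKind] at hadj
    rwa [this] at hw
  have := hM.1.eq_of_adj_right (h 0) (h 1)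
  simp at this

end Extremal

/-! ### The separator from Tutte's theorem. -/

section Tutte

/-- Without a perfect matching, a graph of even order has a separator leaving at least two more
components than the separator has vertices. -/
lemma exists_partition.{u} {V : Type u} [Fintype V] {G : SimpleGraph V} (heven : Even (Fintype.card V))
    (hG : ¬ ∃ M : G.Subgraph, M.IsPerfectMatching) :
    ∃ (ι : Type u) (_ : Fintype ι) (κ : V → Option ι),
      (∀ v u, G.Adj v u → Related κ v u) ∧ (∀ i, ∃ v, κ v = some i) ∧
      fiberCard κ none + 2 ≤ Fintype.card ι := by
  classical
  rw [tutte] at hG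
  push Not at hG
  obtain ⟨S, hS⟩ := hG
  rw [IsTutteViolator] at hS
  set H := ((⊤ : G.Subgraph).deleteVerts S).coe with hH
  have hmem : ∀ v, v ∉ S → v ∈ ((⊤ : G.Subgraph).deleteVerts S).verts := by
    intro v hv; simp [hv]
  let κ : V → Option H.ConnectedComponent := fun v =>
    if h : v ∈ S then none else some (H.connectedComponentMk ⟨v, hmem v h⟩)
  have hnone : ∀ v, κ v = none ↔ v ∈ S := by
    intro v
    by_cases h : v ∈ S <;> simp [κ, h]
  have hsome : ∀ v (h : v ∉ S), κ v = some (H.connectedComponentMk ⟨v, hmem v h⟩) := by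
    intro v h
    simp [κ, h]
  refine ⟨H.ConnectedComponent, Fintype.ofFinite _, κ, ?_, ?_, ?_⟩
  · intro v u h
    by_cases hv : v ∈ S
    · exact Or.inl ((hnone v).2 hv)
    by_cases hu : u ∈ S
    · exact Or.inr (Or.inl ((hnone u).2 hu))
    refine Or.inr (Or.inr ?_)
    rw [hsome v hv, hsome u hu]
    congr 1
    refine ConnectedComponent.sound (Adj.reachable ?_)
    rw [hH, Subgraph.coe_adj, Subgraph.deleteVerts_adj]
    simp [hv, hu, h]
  · intro i
    induction i using ConnectedComponent.ind with
    | _ v =>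
      have hv : v.1 ∉ S := by have := v.2; simpa using this
      exact ⟨v.1, hsome v.1 hv⟩
  · have h1 : fiberCard κ none = S.ncard := by
      rw [fiberCard, ← Set.ncard_coe_finset]
      congr 1
      ext v
      simp [hnone]
    have h2 : S.ncard + Nat.card ((⊤ : G.Subgraph).deleteVerts S).verts = Fintype.card V := by
      have h3 : ((⊤ : G.Subgraph).deleteVerts S).verts = Sᶜ := by
        ext v; simp
      rw [h3, Nat.card_coe_set_eq, Set.ncard_add_ncard_compl, Nat.card_eq_fintype_card]
    -- The number of odd components has the parity of `|V \ S|`, hence of `|S|`, so exceeding `|S|`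
    -- means exceeding it by at least two.
    have h3 := odd_ncard_oddComponents (G := H)
    have h4 : H.oddComponents.ncard ≤ Nat.card H.ConnectedComponent := Set.ncard_le_card _
    rw [Nat.card_eq_fintype_card] at h4
    rw [h1]
    refine le_trans ?_ (h4.trans (le_of_eq (by congr!)))
    rw [← h2] at heven
    rw [Nat.odd_iff, Nat.odd_iff] at h3
    rw [Nat.even_iff] at heven
    omega

end Tutte

/-- The cubic changes sign between `n - 3` and `n + 3`; a root above `n - 3` keeps the entries of
`extremalVector` positive. -/
lemma exists_root_gt {α : ℝ} {n : ℕ} (hα0 : 0 ≤ α) (hα1 : α < 1) (hn : 4 ≤ n) :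
    ∃ r, (n : ℝ) - 3 < r ∧ thresholdCubic α n r = 0 := by
  have hn' : (4 : ℝ) ≤ n := by exact_mod_cast hn
  have hcont : Continuous fun x => thresholdCubic α n x := by unfold thresholdCubic; fun_prop
  have hneg : thresholdCubic α n (n - 3) < 0 := by
    rw [thresholdCubic_eq]
    have h1 : 0 < (1 - α) ^ 3 := pow_pos (by linarith) 3
    have h2 : 0 ≤ (n - 3 - α) * (α * (1 - α)) := mul_nonneg (by linarith) (mul_nonneg hα0 (by linarith))
    nlinarith
  have hpos : 0 ≤ thresholdCubic α n (n + 3) := by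
    rw [thresholdCubic_eq]
    have hb : 0 ≤ 1 - α := by linarith
    have h1 : 0 ≤ (1 - α) * n := mul_nonneg hb (by linarith)
    have h2 : α * (1 - α) ≤ 1 := by nlinarith
    have h3 : (1 - α) ^ 2 ≤ 1 := by nlinarith
    have h4 : 4 ≤ (n + 3 - n + 3) * ((1 - α) * n + (n + 3 - n + 3) - 2) - 2 * α * (1 - α) := by nlinarith
    nlinarith
  obtain ⟨r, ⟨hr1, -⟩, hr⟩ := intermediate_value_Icc (show (n : ℝ) - 3 ≤ n + 3 by linarith)
    hcont.continuousOn ⟨hneg.le, hpos⟩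
  refine ⟨r, lt_of_le_of_ne hr1 ?_, hr⟩
  rintro rfl
  exact hneg.ne hr

end AlphaSpectral

theorem theorem1p3 {V : Type*} [Fintype V] (G : SimpleGraph V) (n : ℕ) (α : ℝ)
    (hα0 : 0 ≤ α) (hα1 : α < 1)
    (hcard : Fintype.card V = n) (heven : Even n)
    (hn : AlphaSpectral.orderBound α ≤ (n : ℝ))
    (hconn : G.Connected) :
    (AlphaSpectral.alphaSpectralRadius (AlphaSpectral.extremalGraph n) α ≤
        AlphaSpectral.alphaSpectralRadius G α →
      ((∃ M : G.Subgraph, M.IsPerfectMatching) ↔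
        ¬ Nonempty (G ≃g AlphaSpectral.extremalGraph n))) ∧
    IsGreatest {x : ℝ | AlphaSpectral.thresholdCubic α n x = 0}
      (AlphaSpectral.alphaSpectralRadius (AlphaSpectral.extremalGraph n) α) := by
  have hn10 : 10 ≤ n := by exact_mod_cast (AlphaSpectral.order_bounds hα1 heven hn).1
  obtain ⟨r, hr, hroot⟩ := AlphaSpectral.exists_root_gt hα0 hα1 (show 4 ≤ n by omega)
  have hrad : ∀ y, (n : ℝ) - 3 < y → AlphaSpectral.thresholdCubic α n y = 0 →
      AlphaSpectral.alphaSpectralRadius (AlphaSpectral.extremalGraph n) α = y :=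
    fun y hy hy0 => AlphaSpectral.alphaSpectralRadius_extremalGraph hα0 hα1 (by omega) hy hy0
  refine ⟨fun hspec => ⟨?_, fun hiso => ?_⟩, ?_⟩
  · rintro ⟨M, hM⟩ ⟨φ⟩
    exact AlphaSpectral.not_isPerfectMatching_of_iso φ M hM
  · by_contra hPM
    obtain ⟨ι, _, κ, hadj, hκ, hparts⟩ := AlphaSpectral.exists_partition (hcard ▸ heven) hPM
    rw [hrad r hr hroot] at hspec
    obtain ⟨hs, ht, hk, hG⟩ := AlphaSpectral.partition_of_le_alphaSpectralRadius hα0 hα1 hcard heven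
      hn hr hroot hconn hadj hκ hparts hspec
    exact hiso (AlphaSpectral.nonempty_iso_of_partition (by omega) hcard hs ht hk hG)
  · rw [hrad r hr hroot]
    refine ⟨hroot, fun y hy => ?_⟩
    by_contra! hlt
    -- A larger root would also equal the spectral radius, hence equal `r`.
    exact hlt.ne ((hrad r hr hroot).symm.trans (hrad y (hr.trans hlt) hy))
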